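/- Let $S^2\subset\mathbb R^3$ be the unit sphere with its round Riemannian metric $g$, let $d$ be the Riemannian distance, $\nabla f$ the Riemannian gradient and $\nabla^2 f$ the Riemannian Hessian, and let $N=(0,0,1)$. A function $f:S^2\to\mathbb R$ is called $c$-concave (for the cost $c=\tfrac12 d^2$) if there is a family $(y_i,a_i)_{i\in I}$ in $S^2\times\mathbb R$ such that $f(x)=\inf_{i\in I}\bigl(\tfrac12 d(x,y_i)^2-a_i\bigr)$ for all $x\in S^2$. Then: 1. There is a constant $\delta>0$ such that every $f\in C^2(S^2)$ with $\|f\|_\infty\le\delta$ for which there exists a point $x\in S^2$ with $\nabla f(x)\neq 0$ and $\nabla^2 f(x)=g_x$ fails to be $c$-concave. 2. For every $\eta>0$ there is $f\in C^2(S^2)$ with $\|f\|_\infty\le\eta$, $\nabla f(N)\ne 0$, $\nabla^2 f(N)=g_N$ and $\nabla^2 f\le g$ everywhere on $S^2$, and which is not $c$-concave. 3. Consequently the statement "a function $f\in C^2(S^2)$ is $c$-concave if and only if $\nabla^2 f\le g$ everywhere" is false. -/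

import Mathlib

open scoped Manifold ContDiff Bundle

noncomputable section

namespace RoundSphere

/-- Euclidean three-space. -/
abbrev R3 : Type := EuclideanSpace ℝ (Fin 3)

instance : Fact (Module.finrank ℝ R3 = 2 + 1) := ⟨finrank_euclideanSpace_fin⟩

/-- The unit sphere `S²` in `ℝ³`, with the smooth manifold structure that Mathlib gives it. -/
abbrev S2 : Type := Metric.sphere (0 : R3) 1

/-- The differential at `x` of the inclusion `S² → ℝ³`. It identifies the abstract tangent space
`T_x S²` with the plane `x^⊥` of `ℝ³`. -/
def dIncl (x : S2) : TangentSpace (𝓡 2) x →L[ℝ] R3 :=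
  mvfderiv (𝓡 2) (fun y : S2 => (y : R3)) x

theorem dIncl_injective (x : S2) : Function.Injective (dIncl x) :=
  injective_mvfderiv_subtypeVal_sphere x

theorem range_dIncl (x : S2) : (dIncl x).range = (Submodule.span ℝ {(x : R3)})ᗮ :=
  range_mvfderiv_subtypeVal x

theorem isVonNBounded_of_injective (L : EuclideanSpace ℝ (Fin 2) →L[ℝ] R3)
    (hL : Function.Injective L) :
    Bornology.IsVonNBounded ℝ {v : EuclideanSpace ℝ (Fin 2) | inner ℝ (L v) (L v) < 1} := by
  obtain ⟨K, -, hK⟩ := (LinearMap.injective_iff_antilipschitz L.toLinearMap).1 hL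
  refine NormedSpace.isVonNBounded_of_isBounded ℝ ?_
  refine (hK.isBounded_preimage (s := Metric.ball (0 : R3) 1) Metric.isBounded_ball).subset ?_
  intro v hv
  have h : ‖L v‖ ^ 2 < 1 := by
    rw [← real_inner_self_eq_norm_sq]
    exact hv
  have h2 : ‖L v‖ < 1 := by nlinarith [norm_nonneg (L v)]
  simpa using h2

/-- The round metric `g` on `S²` at `x`: the pull-back of the Euclidean inner product under the
inclusion, `g_x(u, v) = ⟪dι_x u, dι_x v⟫`. -/
def metricForm (x : S2) : TangentSpace (𝓡 2) x →L[ℝ] TangentSpace (𝓡 2) x →L[ℝ] ℝ :=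
  (ContinuousLinearMap.precomp ℝ (dIncl x)).comp
    ((innerSL ℝ : R3 →L[ℝ] R3 →L[ℝ] ℝ).comp (dIncl x))

theorem metricForm_apply (x : S2) (u v : TangentSpace (𝓡 2) x) :
    metricForm x u v = inner ℝ (dIncl x u) (dIncl x v) := rfl

/-- The round metric as a Riemannian metric on the tangent bundle of `S²`. -/
def roundMetric : Bundle.RiemannianMetric (fun x : S2 => TangentSpace (𝓡 2) x) where
  inner x := metricForm x
  symm x v w := real_inner_comm (dIncl x w) (dIncl x v)
  pos x v hv := by
    have h : dIncl x v ≠ 0 := fun h => hv (dIncl_injective x (by simpa using h))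
    exact real_inner_self_pos.2 h
  continuousAt x := by
    have h : Continuous fun v : TangentSpace (𝓡 2) x => inner ℝ (dIncl x v) (dIncl x v) :=
      (dIncl x).continuous.inner (dIncl x).continuous
    exact h.continuousAt
  isVonNBounded x := isVonNBounded_of_injective (dIncl x) (dIncl_injective x)

/-- From here on each `T_x S²` carries the inner product `g_x`, written `inner ℝ u v`. -/
instance : Bundle.RiemannianBundle (fun x : S2 => TangentSpace (𝓡 2) x) := ⟨roundMetric⟩

theorem inner_eq (x : S2) (u v : TangentSpace (𝓡 2) x) :
    inner ℝ u v = inner ℝ (dIncl x u) (dIncl x v) := rfl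

/-- The Riemannian distance of `(S², g)`: the infimum of the `g`-lengths of the `C¹` curves between
the two points (as a real number). -/
def rdist (x y : S2) : ℝ := (Manifold.riemannianEDist (𝓡 2) x y).toReal

instance (x : S2) : FiniteDimensional ℝ (TangentSpace (𝓡 2) x) :=
  inferInstanceAs (FiniteDimensional ℝ (EuclideanSpace ℝ (Fin 2)))

instance (x : S2) : CompleteSpace (TangentSpace (𝓡 2) x) :=
  FiniteDimensional.complete ℝ _

/-- The Riemannian gradient `∇f(x) ∈ T_x S²`: the vector with `g_x(∇f(x), v) = df_x(v)` for all
`v`. -/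
def grad (f : S2 → ℝ) (x : S2) : TangentSpace (𝓡 2) x :=
  (InnerProductSpace.toDual ℝ (TangentSpace (𝓡 2) x)).symm (mvfderiv (𝓡 2) f x)

theorem inner_grad (f : S2 → ℝ) (x : S2) (v : TangentSpace (𝓡 2) x) :
    inner ℝ (grad f x) v = mvfderiv (𝓡 2) f x v :=
  InnerProductSpace.toDual_symm_apply

/-- The Riemannian Hessian `∇²f(x)(u, v) = g_x(∇_u grad f, v)`. The Levi-Civita derivative
`∇_u grad f` of the surface `S² ⊂ ℝ³` is the part tangent to `S²` of the derivative in direction `u`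
of `grad f`, regarded as a map `S² → ℝ³`; as `v` is tangent, the normal part does not contribute to
the inner product. -/
def hess (f : S2 → ℝ) (x : S2) (u v : TangentSpace (𝓡 2) x) : ℝ :=
  inner ℝ (mvfderiv (𝓡 2) (fun y : S2 => dIncl y (grad f y)) x u) (dIncl x v)

/-- `∇²f(x) = g` at the point `x`. -/
def HessEqMetricAt (f : S2 → ℝ) (x : S2) : Prop :=
  ∀ u v : TangentSpace (𝓡 2) x, hess f x u v = inner ℝ u v

/-- `∇²f(x) ≤ g` at the point `x`, as quadratic forms. -/
def HessLeMetricAt (f : S2 → ℝ) (x : S2) : Prop :=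
  ∀ v : TangentSpace (𝓡 2) x, hess f x v v ≤ inner ℝ v v

/-- `f` is `c`-concave for `c = d²/2`: there is a family of pairs `(y, a) ∈ S² × ℝ` such that
`f(x) = inf (d(x, y)²/2 - a)` for every `x`, the infimum running over the family. (The family is
not empty, since an empty set of reals has no greatest lower bound.) -/
def CConcave (f : S2 → ℝ) : Prop :=
  ∃ A : Set (S2 × ℝ), ∀ x : S2,
    IsGLB ((fun p : S2 × ℝ => rdist x p.1 ^ 2 / 2 - p.2) '' A) (f x)

/-- The north pole `(0, 0, 1)`. -/
def northPole : S2 := ⟨EuclideanSpace.single 2 1, by simp⟩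

end RoundSphere

end

open scoped Manifold ContDiff Bundle

noncomputable section

namespace RoundSphere

/-! The obstruction is positive curvature. At each point x a `c`-concave f is touched from above by
some d(·, y)²/2 - a (`CConcave.exists_support`). If y = x, comparison with t²/2 along great circles
forces ∇f(x) = 0. So y ≠ x at a point where the gradient does not vanish. Follow the great circle
leaving x orthogonally to the direction of y: with θ = d(x, y) the distance to y is arccos(cos θ cos
t). If θ < π/2, half its square has second derivative θ cot θ < 1 at t = 0; if θ ≥ π/2, the distance
does not increase at all. When ∇²f(x) = g, f has second derivative 1 along this circle, which
contradicts the upper bound (`not_cconcave_of_hessEqMetricAt`).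

The example is a sum of ridge functions of four horizontal linear forms plus ε x₀. The forms vanish
at N and a third of the sum of their squares is the horizontal metric, so ∇²f(N) = g, while ε x₀
supplies the gradient. Away from N the linear term can raise the Hessian by ε |x₀|. A deficit of
first order in |x₀| is needed to absorb this, hence the |t| in the second derivative of `ridge`. The
forms x₀ and x₁ alone give no such deficit in the direction e₁ where x₁ = 0; the diagonal forms x₀ ±
x₁ provide it (`touching_hessLe`). -/

/-! ### Gradient, Hessian and great circles through the embedding in ℝ³. -/

theorem mdifferentiableAt_coe (x : S2) :
    MDifferentiableAt (𝓡 2) 𝓘(ℝ, R3) (fun y : S2 => (y : R3)) x :=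
  (contMDiff_coe_sphere (m := 1) x).mdifferentiableAt one_ne_zero

theorem inner_coe_dIncl (x : S2) (v : TangentSpace (𝓡 2) x) : inner ℝ (x : R3) (dIncl x v) = 0 := by
  have h : dIncl x v ∈ (Submodule.span ℝ {(x : R3)})ᗮ := by
    rw [← range_dIncl]
    exact ⟨v, rfl⟩
  exact Submodule.mem_orthogonal_singleton_iff_inner_right.1 h

theorem exists_dIncl_eq {x : S2} {w : R3} (h : inner ℝ (x : R3) w = 0) : ∃ v, dIncl x v = w := by
  have h : w ∈ (Submodule.span ℝ {(x : R3)})ᗮ :=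
    Submodule.mem_orthogonal_singleton_iff_inner_right.2 h
  rw [← range_dIncl] at h
  exact h

theorem enorm_eq_enorm_dIncl (x : S2) (v : TangentSpace (𝓡 2) x) : ‖v‖ₑ = ‖dIncl x v‖ₑ := by
  have h : ‖v‖ = ‖dIncl x v‖ := by
    rw [@norm_eq_sqrt_real_inner _ _ _ v, norm_eq_sqrt_real_inner (dIncl x v), inner_eq]
  rw [← ofReal_norm, h, ofReal_norm]

/-- Chain rule for a vector valued function along a curve. -/
theorem hasDerivAt_comp_curve {F : Type*} [NormedAddCommGroup F] [NormedSpace ℝ F] {g : S2 → F}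
    {γ : ℝ → S2} {t : ℝ} (hg : MDifferentiableAt (𝓡 2) 𝓘(ℝ, F) g (γ t))
    (hγ : MDifferentiableAt 𝓘(ℝ, ℝ) (𝓡 2) γ t) :
    HasDerivAt (fun s => g (γ s))
      (mvfderiv (𝓡 2) g (γ t) (mfderiv 𝓘(ℝ, ℝ) (𝓡 2) γ t (1 : ℝ))) t :=
  HasFDerivAt.hasDerivAt
    (f' := (mvfderiv (𝓡 2) g (γ t)).comp (mfderiv 𝓘(ℝ, ℝ) (𝓡 2) γ t : ℝ →L[ℝ] _))
    (hg.hasMFDerivAt.comp t hγ.hasMFDerivAt).hasFDerivAt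

theorem hasDerivAt_coe_curve {γ : ℝ → S2} {t : ℝ} (hγ : MDifferentiableAt 𝓘(ℝ, ℝ) (𝓡 2) γ t) :
    HasDerivAt (fun s => (γ s : R3)) (dIncl (γ t) (mfderiv 𝓘(ℝ, ℝ) (𝓡 2) γ t (1 : ℝ))) t :=
  hasDerivAt_comp_curve (mdifferentiableAt_coe _) hγ

/-- Chain rule for a function that is the restriction of one on `ℝ³`. -/
theorem mvfderiv_comp_coe {F : Type*} [NormedAddCommGroup F] [NormedSpace ℝ F] {g : R3 → F}
    {g' : R3 →L[ℝ] F} {x : S2} (hg : HasFDerivAt g g' (x : R3)) (v : TangentSpace (𝓡 2) x) :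
    mvfderiv (𝓡 2) (fun y : S2 => g y) x v = g' (dIncl x v) := by
  have h := (hg.hasMFDerivAt.comp x (mdifferentiableAt_coe x).hasMFDerivAt).mfderiv
  exact congrArg (fun L : TangentSpace (𝓡 2) x →L[ℝ] F => L v) h

/-- The gradient, as a vector of `ℝ³`, of the restriction to the sphere of a function on `ℝ³`. -/
theorem dIncl_grad_comp_coe {F : R3 → ℝ} {G : R3} {x : S2}
    (hF : HasFDerivAt F (innerSL ℝ G) (x : R3)) :
    dIncl x (grad (fun y : S2 => F y) x) = G - inner ℝ G (x : R3) • (x : R3) := by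
  have hx : inner ℝ (x : R3) (x : R3) = 1 := by simp
  obtain ⟨v, hv⟩ := exists_dIncl_eq (x := x) (w := G - inner ℝ G (x : R3) • (x : R3)) (by
    rw [inner_sub_right, inner_smul_right, hx, real_inner_comm]; ring)
  rw [← hv]
  congr 1
  refine ext_inner_right ℝ fun u => ?_
  rw [inner_grad, mvfderiv_comp_coe hF, inner_eq, hv, inner_sub_left, inner_smul_left,
    inner_coe_dIncl]
  simp

/-- The Hessian of the restriction to the sphere of a function on `ℝ³`. -/
theorem hess_comp_coe {F : R3 → ℝ} {G : R3 → R3} {x : S2} {G' : R3 →L[ℝ] R3}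
    (hF : ∀ z, HasFDerivAt F (innerSL ℝ (G z)) z) (hG : HasFDerivAt G G' (x : R3))
    (u v : TangentSpace (𝓡 2) x) :
    hess (fun y : S2 => F y) x u v =
      inner ℝ (G' (dIncl x u)) (dIncl x v) -
        inner ℝ (G x) (x : R3) * inner ℝ (dIncl x u) (dIncl x v) := by
  have h : (fun y : S2 => dIncl y (grad (fun y : S2 => F y) y)) =
      fun y : S2 => (fun z : R3 => G z - inner ℝ (G z) z • z) y :=
    funext fun y => dIncl_grad_comp_coe (hF y)
  have hid := hasFDerivAt_id (𝕜 := ℝ) (x : R3)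
  -- The derivative of ⟪G z, z⟫ z in a direction is ⟪G x, x⟫ times that direction plus a multiple of
  -- x, and the latter is orthogonal to tangent vectors.
  have hW : HasFDerivAt (fun z : R3 => G z - inner ℝ (G z) z • z) _ (x : R3) :=
    hG.sub ((hG.inner ℝ hid).smul hid)
  rw [hess, h, mvfderiv_comp_coe hW]
  simp [inner_sub_left, inner_add_left, inner_smul_left, inner_coe_dIncl]

/-- A curve on the sphere that is smooth in `ℝ³` is smooth. -/
theorem contMDiff_curve {γ : ℝ → S2} {n : ℕ∞ω} (h : ContDiff ℝ n fun t => (γ t : R3)) :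
    ContMDiff 𝓘(ℝ, ℝ) (𝓡 2) n γ :=
  (h.contMDiff).codRestrict_sphere (n := 2) fun t => (γ t).2

theorem cos_smul_add_sin_smul_mem {x w : R3} (hx : ‖x‖ = 1) (hw : ‖w‖ = 1) (h : inner ℝ x w = 0)
    (t : ℝ) : Real.cos t • x + Real.sin t • w ∈ Metric.sphere (0 : R3) 1 := by
  rw [mem_sphere_zero_iff_norm, ← sq_eq_sq₀ (norm_nonneg _) zero_le_one, norm_add_sq_real,
    norm_smul, norm_smul, inner_smul_left, inner_smul_right, h, hx, hw]
  simp

/-- The unit speed great circle through `x` with initial velocity `w`. -/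
def greatCircle (x : S2) (w : R3) (hw : ‖w‖ = 1) (h : inner ℝ (x : R3) w = 0) (t : ℝ) : S2 :=
  ⟨Real.cos t • (x : R3) + Real.sin t • w,
    cos_smul_add_sin_smul_mem (norm_eq_of_mem_sphere x) hw h t⟩

section greatCircle

variable (x : S2) (w : R3) (hw : ‖w‖ = 1) (h : inner ℝ (x : R3) w = 0)

theorem coe_greatCircle (t : ℝ) :
    (greatCircle x w hw h t : R3) = Real.cos t • (x : R3) + Real.sin t • w := rfl

theorem greatCircle_zero : greatCircle x w hw h 0 = x := by
  ext1
  simp [coe_greatCircle]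

theorem contMDiff_greatCircle {n : ℕ∞ω} :
    ContMDiff 𝓘(ℝ, ℝ) (𝓡 2) n (greatCircle x w hw h) :=
  contMDiff_curve ((Real.contDiff_cos.smul contDiff_const).add
    (Real.contDiff_sin.smul contDiff_const))

theorem mdifferentiableAt_greatCircle (t : ℝ) :
    MDifferentiableAt 𝓘(ℝ, ℝ) (𝓡 2) (greatCircle x w hw h) t :=
  (contMDiff_greatCircle x w hw h (n := 1) t).mdifferentiableAt one_ne_zero

theorem dIncl_mfderiv_greatCircle (t : ℝ) :
    dIncl _ (mfderiv 𝓘(ℝ, ℝ) (𝓡 2) (greatCircle x w hw h) t (1 : ℝ)) =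
      -Real.sin t • (x : R3) + Real.cos t • w :=
  (hasDerivAt_coe_curve (mdifferentiableAt_greatCircle x w hw h t)).unique
    (((Real.hasDerivAt_cos t).smul_const _).add ((Real.hasDerivAt_sin t).smul_const _))

/-- The first derivative of a function along a great circle. -/
theorem hasDerivAt_comp_greatCircle {f : S2 → ℝ} (t : ℝ)
    (hf : MDifferentiableAt (𝓡 2) 𝓘(ℝ, ℝ) f (greatCircle x w hw h t)) :
    HasDerivAt (fun s => f (greatCircle x w hw h s))
      (inner ℝ (dIncl (greatCircle x w hw h t) (grad f (greatCircle x w hw h t)))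
        (-Real.sin t • (x : R3) + Real.cos t • w)) t := by
  have h1 := hasDerivAt_comp_curve hf (mdifferentiableAt_greatCircle x w hw h t)
  rwa [← inner_grad, inner_eq, dIncl_mfderiv_greatCircle] at h1

/-- The second derivative of a function along a great circle is given by the Hessian. -/
theorem hasDerivAt_deriv_comp_greatCircle {f : S2 → ℝ} (hf : MDifferentiable (𝓡 2) 𝓘(ℝ, ℝ) f)
    (hg : MDifferentiableAt (𝓡 2) 𝓘(ℝ, R3) (fun y : S2 => dIncl y (grad f y)) x)
    {u : TangentSpace (𝓡 2) x} (hu : dIncl x u = w) :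
    HasDerivAt (deriv fun s => f (greatCircle x w hw h s)) (hess f x u u) 0 := by
  have h0 := greatCircle_zero x w hw h
  have h1 : (deriv fun s => f (greatCircle x w hw h s)) = fun t =>
      inner ℝ (dIncl (greatCircle x w hw h t) (grad f (greatCircle x w hw h t)))
        (-Real.sin t • (x : R3) + Real.cos t • w) :=
    funext fun t => (hasDerivAt_comp_greatCircle x w hw h t (hf _)).deriv
  have h2 : HasDerivAt (fun t => dIncl (greatCircle x w hw h t) (grad f (greatCircle x w hw h t)))
      (mvfderiv (𝓡 2) (fun y : S2 => dIncl y (grad f y)) x u) 0 := by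
    have hg' : MDifferentiableAt (𝓡 2) 𝓘(ℝ, R3) (fun y : S2 => dIncl y (grad f y))
        (greatCircle x w hw h 0) := by rwa [h0]
    have h3 := hasDerivAt_comp_curve hg' (mdifferentiableAt_greatCircle x w hw h 0)
    refine h3.congr_deriv ?_
    have h4 := dIncl_mfderiv_greatCircle x w hw h 0
    revert h4
    generalize mfderiv 𝓘(ℝ, ℝ) (𝓡 2) (greatCircle x w hw h) 0 (1 : ℝ) = v
    revert v
    rw [h0]
    intro v h4
    rw [dIncl_injective x (hu.trans (by simpa using h4.symm) : dIncl x u = dIncl x v)]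
  rw [h1]
  -- In the product rule the acceleration of the great circle at 0 is -x, which is orthogonal to the
  -- gradient; only the Hessian term survives.
  refine (h2.inner ℝ (((Real.hasDerivAt_sin 0).neg.smul_const (x : R3)).add
    ((Real.hasDerivAt_cos 0).smul_const w))).congr_deriv ?_
  have h3 := inner_coe_dIncl (greatCircle x w hw h 0) (grad f (greatCircle x w hw h 0))
  simp only [coe_greatCircle, Real.cos_zero, Real.sin_zero, one_smul, zero_smul, add_zero] at h3
  simp [hess, hu, inner_neg_right, real_inner_comm, h3]

end greatCircle

/-! ### The Riemannian distance is the angle. -/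

section

open MeasureTheory Manifold InnerProductGeometry

theorem exists_unit_orthogonal (x y : R3) :
    ∃ w : R3, ‖w‖ = 1 ∧ inner ℝ x w = 0 ∧ inner ℝ y w = 0 := by
  have h : (Submodule.span ℝ ({x, y} : Set R3))ᗮ ≠ ⊥ := by
    intro h
    rw [Submodule.orthogonal_eq_bot_iff] at h
    have h1 := finrank_span_finset_le_card (R := ℝ) ({x, y} : Finset R3)
    have h2 := Finset.card_le_two (a := x) (b := y)
    rw [Set.finrank, Finset.coe_pair, h, finrank_top, finrank_euclideanSpace_fin] at h1
    omega
  obtain ⟨v, hv, hv0⟩ := Submodule.exists_mem_ne_zero_of_ne_bot h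
  have h1 : ∀ z ∈ ({x, y} : Set R3), inner ℝ z v = 0 := fun z hz =>
    Submodule.inner_right_of_mem_orthogonal (Submodule.subset_span hz) hv
  refine ⟨‖v‖⁻¹ • v, by simp [norm_smul, hv0], ?_, ?_⟩
  · rw [inner_smul_right, h1 x (by simp), mul_zero]
  · rw [inner_smul_right, h1 y (by simp), mul_zero]

/-- Every point lies on a great circle issued from a given one, at parameter the angle. -/
theorem exists_cos_smul_add_sin_smul {x y : R3} (hx : ‖x‖ = 1) (hy : ‖y‖ = 1) :
    ∃ w : R3, ‖w‖ = 1 ∧ inner ℝ x w = 0 ∧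
      y = Real.cos (angle x y) • x + Real.sin (angle x y) • w := by
  have hc : Real.cos (angle x y) = inner ℝ x y := by simp [cos_angle, hx, hy]
  have hxx : inner ℝ x x = 1 := by simp [hx]
  have hn : ‖y - Real.cos (angle x y) • x‖ ^ 2 = Real.sin (angle x y) ^ 2 := by
    rw [norm_sub_sq_real, norm_smul, inner_smul_right, real_inner_comm, ← hc, hx, hy,
      Real.sin_sq, Real.norm_eq_abs, mul_one, sq_abs]
    ring
  have hn : ‖y - Real.cos (angle x y) • x‖ = Real.sin (angle x y) :=
    (sq_eq_sq₀ (norm_nonneg _) (sin_angle_nonneg x y)).1 hn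
  rcases eq_or_ne (Real.sin (angle x y)) 0 with h0 | h0
  -- Here y = ±x, and any unit tangent vector serves.
  · obtain ⟨w, hw, hw', -⟩ := exists_unit_orthogonal x x
    rw [h0, norm_eq_zero, sub_eq_zero] at hn
    exact ⟨w, hw, hw', by rw [h0, zero_smul, add_zero, ← hn]⟩
  · refine ⟨(Real.sin (angle x y))⁻¹ • (y - Real.cos (angle x y) • x), ?_, ?_, ?_⟩
    · rw [norm_smul, hn, norm_inv, Real.norm_of_nonneg (sin_angle_nonneg x y), inv_mul_cancel₀ h0]
    · rw [inner_smul_right, inner_sub_right, inner_smul_right, hxx, hc]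
      ring
    · rw [smul_inv_smul₀ h0]
      abel

theorem norm_velocity_greatCircle {x w : R3} (hx : ‖x‖ = 1) (hw : ‖w‖ = 1) (h : inner ℝ x w = 0)
    (t : ℝ) : ‖-Real.sin t • x + Real.cos t • w‖ = 1 := by
  rw [← sq_eq_sq₀ (norm_nonneg _) zero_le_one, norm_add_sq_real,
    norm_smul, norm_smul, inner_smul_left, inner_smul_right, h, hw, hx]
  simp

theorem riemannianEDist_le_angle (x y : S2) :
    riemannianEDist (𝓡 2) x y ≤ ENNReal.ofReal (angle (x : R3) y) := by
  obtain ⟨w, hw, h, hy⟩ :=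
    exists_cos_smul_add_sin_smul (norm_eq_of_mem_sphere x) (norm_eq_of_mem_sphere y)
  refine (riemannianEDist_le_pathELength (a := 0) (b := angle (x : R3) y)
    (contMDiff_greatCircle x w hw h).contMDiffOn (greatCircle_zero x w hw h)
    (Subtype.ext hy.symm) (angle_nonneg _ _)).trans_eq ?_
  rw [pathELength_eq_lintegral_mfderiv_Icc]
  have h1 : ∀ t, ‖mfderiv 𝓘(ℝ, ℝ) (𝓡 2) (greatCircle x w hw h) t (1 : ℝ)‖ₑ = 1 := fun t => by
    rw [enorm_eq_enorm_dIncl, dIncl_mfderiv_greatCircle, ← ofReal_norm,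
      norm_velocity_greatCircle (norm_eq_of_mem_sphere x) hw h, ENNReal.ofReal_one]
  refine (lintegral_congr h1).trans ?_
  simp

/-- Only the part of p orthogonal to c contributes, and it has norm √(1 - ⟪p, c⟫²). -/
theorem abs_inner_le_of_orthogonal {c p v : R3} (hc : ‖c‖ = 1) (hp : ‖p‖ = 1)
    (h : inner ℝ c v = 0) : |inner ℝ p v| ≤ ‖v‖ * √(1 - inner ℝ p c ^ 2) := by
  have h1 : inner ℝ p v = inner ℝ (p - inner ℝ p c • c) v := by
    rw [inner_sub_left, inner_smul_left, h]
    simp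
  have h2 : ‖p - inner ℝ p c • c‖ = √(1 - inner ℝ p c ^ 2) := by
    rw [← Real.sqrt_sq (norm_nonneg (p - _)), norm_sub_sq_real, norm_smul, inner_smul_right, hc,
      hp, Real.norm_eq_abs, mul_one, sq_abs]
    congr 1
    ring
  rw [h1, ← h2, mul_comm]
  exact abs_real_inner_le_norm _ _

/-- Scaling the height `⟪p, c⟫` by `k < 1` keeps `arccos` smooth; its derivative along a curve on the
sphere is at most the speed of the curve. -/
theorem arccos_mul_inner_sub_le {c : ℝ → R3} (hc : ContDiff ℝ 1 c) (hs : ∀ t, ‖c t‖ = 1) {p : R3}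
    (hp : ‖p‖ = 1) {k : ℝ} (hk0 : 0 ≤ k) (hk1 : k < 1) :
    Real.arccos (k * inner ℝ p (c 1)) - Real.arccos (k * inner ℝ p (c 0)) ≤
      ∫ t in (0 : ℝ)..1, ‖deriv c t‖ := by
  have hd : ∀ t, HasDerivAt c (deriv c t) t := fun t =>
    (hc.differentiable one_ne_zero t).hasDerivAt
  have hle : ∀ t, |inner ℝ p (c t)| ≤ 1 := fun t => by
    simpa [hp, hs] using abs_real_inner_le_norm p (c t)
  have hlt : ∀ t, |k * inner ℝ p (c t)| < 1 := fun t => by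
    rw [abs_mul, abs_of_nonneg hk0]
    nlinarith [hle t, abs_nonneg (inner ℝ p (c t))]
  have hu : ∀ t, HasDerivAt (fun t => k * inner ℝ p (c t)) (k * inner ℝ p (deriv c t)) t :=
    fun t => by simpa using ((hasDerivAt_const t p).inner ℝ (hd t)).const_mul k
  have ha : ∀ t, HasDerivAt (fun t => Real.arccos (k * inner ℝ p (c t)))
      (-(1 / √(1 - (k * inner ℝ p (c t)) ^ 2)) * (k * inner ℝ p (deriv c t))) t := fun t =>
    HasDerivAt.comp (h₂ := Real.arccos) t
      (Real.hasDerivAt_arccos (abs_lt.1 (hlt t)).1.ne' (abs_lt.1 (hlt t)).2.ne) (hu t)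
  have hcont : Continuous fun t => ‖deriv c t‖ := (hc.continuous_deriv le_rfl).norm
  refine intervalIntegral.sub_le_integral_of_hasDeriv_right_of_le zero_le_one
    (fun t _ => (ha t).continuousAt.continuousWithinAt) (fun t _ => (ha t).hasDerivWithinAt)
    (hcont.integrableOn_Icc) fun t _ => ?_
  have ho : inner ℝ (c t) (deriv c t) = 0 := by
    have h1 := (hd t).inner ℝ (hd t)
    have h2 : (fun t => inner ℝ (c t) (c t)) = fun _ => (1 : ℝ) := by
      funext t; simp [hs]
    rw [h2] at h1
    have h3 := h1.unique (hasDerivAt_const t (1 : ℝ))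
    have h4 := real_inner_comm (c t) (deriv c t)
    linarith
  have hpos : 0 < 1 - (k * inner ℝ p (c t)) ^ 2 := by
    have := (sq_lt_one_iff_abs_lt_one _).2 (hlt t)
    linarith
  have h1 := abs_inner_le_of_orthogonal (hs t) hp ho
  have h2 : k * √(1 - inner ℝ p (c t) ^ 2) ≤ √(1 - (k * inner ℝ p (c t)) ^ 2) := by
    refine Real.le_sqrt_of_sq_le ?_
    have h3 := (sq_le_one_iff_abs_le_one _).2 (hle t)
    rw [mul_pow, Real.sq_sqrt (by linarith)]
    nlinarith
  have hsq := Real.sqrt_pos.2 hpos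
  calc -(1 / √(1 - (k * inner ℝ p (c t)) ^ 2)) * (k * inner ℝ p (deriv c t))
      ≤ |-(1 / √(1 - (k * inner ℝ p (c t)) ^ 2)) * (k * inner ℝ p (deriv c t))| := le_abs_self _
    _ = k * |inner ℝ p (deriv c t)| / √(1 - (k * inner ℝ p (c t)) ^ 2) := by
      rw [abs_mul, abs_neg, abs_mul, abs_of_nonneg hk0, abs_of_pos (by positivity)]
      ring
    _ ≤ ‖deriv c t‖ := by
      rw [div_le_iff₀ hsq]
      calc k * |inner ℝ p (deriv c t)| ≤ k * (‖deriv c t‖ * √(1 - inner ℝ p (c t) ^ 2)) := by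
            gcongr
        _ = ‖deriv c t‖ * (k * √(1 - inner ℝ p (c t) ^ 2)) := by ring
        _ ≤ _ := by gcongr

/-- Take p = c 0 in `arccos_mul_inner_sub_le` and let k tend to 1 from below; this avoids the
singularities of arccos at ±1. -/
theorem angle_le_integral_norm_deriv {c : ℝ → R3} (hc : ContDiff ℝ 1 c) (hs : ∀ t, ‖c t‖ = 1) :
    angle (c 0) (c 1) ≤ ∫ t in (0 : ℝ)..1, ‖deriv c t‖ := by
  have h1 : Filter.Tendsto (fun k : ℝ =>
      Real.arccos (k * inner ℝ (c 0) (c 1)) - Real.arccos (k * inner ℝ (c 0) (c 0)))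
      (nhdsWithin 1 (Set.Iio 1)) (nhds (angle (c 0) (c 1))) := by
    have h2 : Continuous fun k : ℝ =>
        Real.arccos (k * inner ℝ (c 0) (c 1)) - Real.arccos (k * inner ℝ (c 0) (c 0)) := by
      fun_prop
    have h3 := (h2.tendsto 1).mono_left (nhdsWithin_le_nhds (s := Set.Iio 1))
    simpa [hs, angle] using h3
  refine le_of_tendsto h1 ?_
  filter_upwards [Ioo_mem_nhdsLT (zero_lt_one' ℝ)] with k hk
  exact arccos_mul_inner_sub_le hc hs (hs 0) hk.1.le hk.2

theorem angle_le_riemannianEDist (x y : S2) :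
    ENNReal.ofReal (angle (x : R3) y) ≤ riemannianEDist (𝓡 2) x y := by
  refine le_of_forall_gt fun r hr => ?_
  -- An almost minimizing curve can be chosen `C¹` on all of ℝ, as the Euclidean estimate requires.
  obtain ⟨γ, hγ0, hγ1, hγ, hlen, -, -⟩ :=
    exists_lt_locally_constant_of_riemannianEDist_lt hr (zero_lt_one' ℝ)
  refine lt_of_le_of_lt ?_ hlen
  have hc : ContDiff ℝ 1 fun t => (γ t : R3) :=
    ((contMDiff_coe_sphere (E := R3) (n := 2)).comp hγ).contDiff
  have h1 := angle_le_integral_norm_deriv hc fun t => norm_eq_of_mem_sphere (γ t)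
  rw [hγ0, hγ1] at h1
  refine (ENNReal.ofReal_le_ofReal h1).trans ?_
  rw [intervalIntegral.integral_of_le zero_le_one, ofReal_integral_norm_eq_lintegral_enorm
    ((hc.continuous_deriv le_rfl).integrableOn_Ioc), pathELength_eq_lintegral_mfderiv_Icc]
  refine (lintegral_mono_set Set.Ioc_subset_Icc_self).trans_eq (lintegral_congr fun t => ?_)
  rw [enorm_eq_enorm_dIncl, (hasDerivAt_coe_curve
    ((hγ t).mdifferentiableAt one_ne_zero)).deriv]
  rfl

/-- The Riemannian distance of the round sphere is the angle. -/
theorem rdist_eq_angle (x y : S2) : rdist x y = angle (x : R3) y := by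
  rw [rdist, le_antisymm (riemannianEDist_le_angle x y) (angle_le_riemannianEDist x y),
    ENNReal.toReal_ofReal (angle_nonneg _ _)]

end

/-! ### Regularity of the gradient of a `C²` function. -/

theorem inv_norm_smul_mem_sphere {z : R3} (hz : z ≠ 0) :
    ‖z‖⁻¹ • z ∈ Metric.sphere (0 : R3) 1 := by
  rw [mem_sphere_zero_iff_norm, norm_smul, norm_inv, norm_norm,
    inv_mul_cancel₀ (norm_ne_zero_iff.2 hz)]

open Classical in
/-- The extension of a function on the sphere to `ℝ³ \ {0}` that is constant on rays. -/
def radialExtension (f : S2 → ℝ) (z : R3) : ℝ :=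
  if hz : z ≠ 0 then f ⟨‖z‖⁻¹ • z, inv_norm_smul_mem_sphere hz⟩ else 0

theorem radialExtension_coe (f : S2 → ℝ) (x : S2) : radialExtension f (x : R3) = f x := by
  rw [radialExtension, dif_pos (ne_zero_of_mem_unit_sphere x)]
  congr 1
  ext1
  simp

theorem contDiffAt_radialExtension {f : S2 → ℝ} {n : ℕ∞ω} (hf : ContMDiff (𝓡 2) 𝓘(ℝ, ℝ) n f)
    {z : R3} (hz : z ≠ 0) : ContDiffAt ℝ n (radialExtension f) z := by
  let U : TopologicalSpace.Opens R3 := ⟨{0}ᶜ, isOpen_compl_singleton⟩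
  have h1 : ContMDiff 𝓘(ℝ, R3) 𝓘(ℝ, R3) n fun u : U => ‖(u : R3)‖⁻¹ • (u : R3) := fun u => by
    refine contMDiffAt_subtype_iff (f := fun z : R3 => ‖z‖⁻¹ • z).2 ?_
    have hu : (u : R3) ≠ 0 := u.2
    exact (((contDiffAt_norm ℝ hu).inv (norm_ne_zero_iff.2 hu)).smul contDiffAt_id).contMDiffAt
  have h2 := hf.comp (h1.codRestrict_sphere (n := 2) fun u => inv_norm_smul_mem_sphere u.2)
  refine (contMDiffAt_subtype_iff (U := U) (x := ⟨z, hz⟩)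
    (f := radialExtension f)).1 ((h2 _).congr_of_eventuallyEq ?_) |>.contDiffAt
  refine Filter.Eventually.of_forall fun u => ?_
  have hu : (u : R3) ≠ 0 := u.2
  exact dif_pos hu

/-- The gradient of a `C²` function is differentiable. -/
theorem mdifferentiable_dIncl_grad {f : S2 → ℝ} (hf : ContMDiff (𝓡 2) 𝓘(ℝ, ℝ) 2 f) :
    MDifferentiable (𝓡 2) 𝓘(ℝ, R3) fun y : S2 => dIncl y (grad f y) := by
  intro x
  -- The gradient field of f is the tangential part of the Euclidean gradient of this extension,
  -- which is `C¹` near the sphere.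
  set F := radialExtension f with hF
  set D := (InnerProductSpace.toDual ℝ R3).symm with hD
  have hFd : ∀ y : S2, HasFDerivAt F (innerSL ℝ (D (fderiv ℝ F y))) (y : R3) := fun y => by
    have h1 := (contDiffAt_radialExtension hf
      (ne_zero_of_mem_unit_sphere y)).differentiableAt two_ne_zero |>.hasFDerivAt
    refine h1.congr_fderiv ?_
    ext v
    rw [innerSL_apply_apply, hD, InnerProductSpace.toDual_symm_apply]
  have h1 : (fun y : S2 => dIncl y (grad f y)) = fun y : S2 =>
      (fun z : R3 => D (fderiv ℝ F z) - inner ℝ (D (fderiv ℝ F z)) z • z) y := by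
    funext y
    have h2 := dIncl_grad_comp_coe (hFd y)
    simp only [hF, radialExtension_coe] at h2
    exact h2
  have h2 : DifferentiableAt ℝ (fderiv ℝ F) (x : R3) :=
    ((contDiffAt_radialExtension hf (ne_zero_of_mem_unit_sphere x)).fderiv_right
      (m := 1) (by norm_num)).differentiableAt one_ne_zero
  have h3 : DifferentiableAt ℝ (fun z => D (fderiv ℝ F z)) (x : R3) :=
    D.toContinuousLinearEquiv.differentiableAt.comp (x : R3) h2
  rw [h1]
  exact MDifferentiableAt.comp (I' := 𝓘(ℝ, R3))
    (g := fun z : R3 => D (fderiv ℝ F z) - inner ℝ (D (fderiv ℝ F z)) z • z) x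
    ((h3.sub ((h3.inner ℝ differentiableAt_id).smul differentiableAt_id)).mdifferentiableAt)
    (mdifferentiableAt_coe x)

/-! ### The obstruction to `c`-concavity. -/

section

open Filter Topology InnerProductGeometry

theorem continuous_rdist_right (x : S2) : Continuous fun y : S2 => rdist x y := by
  simp only [rdist_eq_angle, angle]
  have h : ∀ y : S2, ‖(y : R3)‖ = 1 := fun y => norm_eq_of_mem_sphere y
  simp only [h]
  fun_prop

/-- A `c`-concave function is touched from above at each point by a function `d(·, y)²/2 - a`. -/
theorem CConcave.exists_support {f : S2 → ℝ} (hf : CConcave f) (x : S2) :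
    ∃ y : S2, ∀ z : S2, f z - f x ≤ (rdist z y ^ 2 - rdist x y ^ 2) / 2 := by
  obtain ⟨A, hA⟩ := hf
  -- The infimum at x need not be attained in A. The points of a minimizing sequence subconverge by
  -- compactness, and the constants cancel in the difference of the values at z and x.
  have h1 : ∀ n : ℕ, ∃ p ∈ A, rdist x p.1 ^ 2 / 2 - p.2 < f x + 1 / ((n : ℝ) + 1) := fun n => by
    obtain ⟨_, ⟨p, hp, rfl⟩, h⟩ := (isGLB_lt_iff (hA x)).1
      (lt_add_of_pos_right (f x) (Nat.one_div_pos_of_nat (α := ℝ) (n := n)))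
    exact ⟨p, hp, h⟩
  choose p hpA hp using h1
  obtain ⟨y, φ, hφ, hy⟩ := CompactSpace.tendsto_subseq fun n => (p n).1
  refine ⟨y, fun z => ?_⟩
  have hlim : ∀ u : S2, Tendsto (fun n => rdist u (p (φ n)).1) atTop (𝓝 (rdist u y)) := fun u =>
    ((continuous_rdist_right u).tendsto y).comp hy
  have h2 : Tendsto (fun n => (rdist z (p (φ n)).1 ^ 2 - rdist x (p (φ n)).1 ^ 2) / 2 +
      1 / ((φ n : ℝ) + 1)) atTop (𝓝 ((rdist z y ^ 2 - rdist x y ^ 2) / 2 + 0)) :=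
    ((((hlim z).pow 2).sub ((hlim x).pow 2)).div_const 2).add
      (tendsto_one_div_add_atTop_nhds_zero_nat.comp hφ.tendsto_atTop)
  rw [add_zero] at h2
  refine ge_of_tendsto' h2 fun n => ?_
  have h3 : f z ≤ rdist z (p (φ n)).1 ^ 2 / 2 - (p (φ n)).2 :=
    (hA z).1 ⟨p (φ n), hpA _, rfl⟩
  have h4 := hp (φ n)
  linarith

/-- For b strictly between c and 1, φ - b t²/2 has a strict local maximum at 0 by the bound, yet a
local minimum by the second derivative test. -/
theorem false_of_le_add_mul_sq {φ : ℝ → ℝ} (h1 : Differentiable ℝ φ)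
    (h2 : HasDerivAt (deriv φ) 1 0) {c : ℝ} (hc : c < 1)
    (h : ∀ᶠ t in 𝓝 0, φ t ≤ φ 0 + c * t ^ 2 / 2) : False := by
  set b := (1 + c) / 2 with hb
  set k : ℝ → ℝ := fun t => φ t - b * t ^ 2 / 2 with hk
  have hd : ∀ t, HasDerivAt k (deriv φ t - b * t) t := fun t => by
    have h3 := (h1 t).hasDerivAt.sub ((((hasDerivAt_id t).pow 2).const_mul b).div_const 2)
    refine h3.congr_deriv ?_
    simp
    ring
  have hdk : deriv k = fun t => deriv φ t - b * t := funext fun t => (hd t).deriv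
  have hmax : IsLocalMax k 0 := by
    filter_upwards [h] with t ht
    simp only [hk]
    nlinarith [sq_nonneg t]
  have hmin : IsLocalMin k 0 := by
    refine isLocalMin_of_deriv_deriv_pos ?_ hmax.deriv_eq_zero (hd 0).continuousAt
    have h3 : HasDerivAt (fun t => deriv φ t - b * t) (1 - b * 1) 0 :=
      h2.sub ((hasDerivAt_id (0 : ℝ)).const_mul b)
    rw [hdk, h3.deriv]
    linarith
  have h4 : ∀ᶠ t in 𝓝[≠] (0 : ℝ), False := by
    filter_upwards [nhdsWithin_le_nhds h, nhdsWithin_le_nhds hmin, self_mem_nhdsWithin]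
      with t ht1 ht2 ht
    have ht : 0 < t ^ 2 := sq_pos_of_ne_zero ht
    simp only [hk] at ht2
    nlinarith
  exact h4.exists.elim fun _ h => h

/-- Along a great circle that leaves orthogonally to the direction of a point at distance
`θ ∈ (0, π]`, half the squared distance to this point has second derivative less than `1`. -/
theorem exists_arccos_sq_le {θ : ℝ} (h0 : 0 < θ) (hπ : θ ≤ Real.pi) :
    ∃ c < 1, ∀ᶠ t in 𝓝 (0 : ℝ),
      Real.arccos (Real.cos θ * Real.cos t) ^ 2 ≤ θ ^ 2 + c * t ^ 2 := by
  rcases le_or_gt (Real.cos θ) 0 with hc | hc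
  -- When cos θ ≤ 0, multiplying it by cos t does not decrease it, so the distance stays at most θ.
  · refine ⟨0, zero_lt_one, Eventually.of_forall fun t => ?_⟩
    have h1 : Real.cos θ ≤ Real.cos θ * Real.cos t := by nlinarith [Real.cos_le_one t]
    have h2 := Real.arccos_le_arccos h1
    rw [Real.arccos_cos h0.le hπ] at h2
    nlinarith [Real.arccos_nonneg (Real.cos θ * Real.cos t)]
  · have hθ : θ < Real.pi / 2 := by
      by_contra h
      exact hc.not_ge (Real.cos_nonpos_of_pi_div_two_le_of_le (not_lt.1 h)
        (hπ.trans (by linarith [Real.pi_pos])))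
    have hs : 0 < Real.sin θ := Real.sin_pos_of_pos_of_lt_pi h0 (by linarith)
    set κ := Real.cos θ / Real.sin θ with hκ
    have hκ0 : 0 < κ := by positivity
    have hκ1 : θ * κ < 1 := by
      have h1 := Real.lt_tan h0 hθ
      rw [Real.tan_eq_sin_div_cos, lt_div_iff₀ hc] at h1
      rwa [hκ, ← mul_div_assoc, div_lt_one hs]
    -- The exact second derivative is θκ = θ cot θ; the midpoint between it and 1 leaves room for
    -- the quartic term κ²t⁴/4 of (θ + κt²/2)².
    refine ⟨(1 + θ * κ) / 2, by linarith, ?_⟩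
    have hsmall : ∀ᶠ t in 𝓝 (0 : ℝ), κ ^ 2 * t ^ 2 / 4 < (1 - θ * κ) / 2 := by
      have h1 : Continuous fun t : ℝ => κ ^ 2 * t ^ 2 / 4 := by fun_prop
      exact (h1.tendsto 0).eventually (gt_mem_nhds (by simp; linarith))
    have hcos : ∀ᶠ t in 𝓝 (0 : ℝ), 0 < Real.cos t :=
      (Real.continuous_cos.tendsto 0).eventually (lt_mem_nhds (by simp))
    filter_upwards [hsmall, hcos] with t ht hct
    set d := Real.arccos (Real.cos θ * Real.cos t) with hd
    have hle : Real.cos θ * Real.cos t ≤ Real.cos θ := by nlinarith [Real.cos_le_one t]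
    have hdθ : θ ≤ d := by
      have h1 := Real.arccos_le_arccos hle
      rwa [Real.arccos_cos h0.le hπ] at h1
    have hd2 : d ≤ Real.pi / 2 := Real.arccos_le_pi_div_two.2 (by positivity)
    have hcd : Real.cos d = Real.cos θ * Real.cos t :=
      Real.cos_arccos (by nlinarith) (hle.trans (Real.cos_le_one θ))
    -- Mean value theorem for cos on [θ, d] ⊂ [0, π/2], where sin is at least sin θ, together with 1
    -- - cos t ≤ t²/2.
    have hdle : d ≤ θ + κ * t ^ 2 / 2 := by
      rcases hdθ.eq_or_lt with h1 | h1
      · rw [← h1]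
        nlinarith [sq_nonneg t]
      · obtain ⟨s, hs1, hs2⟩ := exists_hasDerivAt_eq_slope Real.cos (fun s => -Real.sin s) h1
          Real.continuous_cos.continuousOn fun s _ => Real.hasDerivAt_cos s
        have h2 : Real.sin θ ≤ Real.sin s :=
          Real.sin_le_sin_of_le_of_le_pi_div_two (by linarith) (by linarith [hs1.2]) hs1.1.le
        rw [eq_div_iff (by linarith), hcd] at hs2
        have h3 := Real.one_sub_sq_div_two_le_cos (x := t)
        have h4 : Real.sin θ * (d - θ) ≤ Real.cos θ * (t ^ 2 / 2) := by nlinarith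
        have h5 : d - θ ≤ Real.cos θ * (t ^ 2 / 2) / Real.sin θ := by
          rw [le_div_iff₀ hs]
          linarith
        have h6 : Real.cos θ * (t ^ 2 / 2) / Real.sin θ = κ * t ^ 2 / 2 := by
          rw [hκ]; ring
        linarith
    have h7 : d ^ 2 ≤ (θ + κ * t ^ 2 / 2) ^ 2 := pow_le_pow_left₀ (h0.le.trans hdθ) hdle 2
    nlinarith [sq_nonneg t]

/-- The spherical Pythagorean theorem: the angle at x is right. -/
theorem rdist_greatCircle (x y : S2) (w : R3) (hw : ‖w‖ = 1) (h : inner ℝ (x : R3) w = 0)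
    (hy : inner ℝ (y : R3) w = 0) (t : ℝ) :
    rdist (greatCircle x w hw h t) y = Real.arccos (Real.cos (rdist x y) * Real.cos t) := by
  rw [rdist_eq_angle, rdist_eq_angle, cos_angle, angle, coe_greatCircle, inner_add_left,
    inner_smul_left, inner_smul_left, real_inner_comm (y : R3) w, hy, ← coe_greatCircle x w hw h]
  simp [norm_eq_of_mem_sphere, mul_comm]

theorem rdist_self (x : S2) : rdist x x = 0 := by
  rw [rdist_eq_angle, angle_self (ne_zero_of_mem_unit_sphere x)]

theorem rdist_pos {x y : S2} (h : x ≠ y) : 0 < rdist x y := by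
  rw [rdist_eq_angle]
  refine (angle_nonneg _ _).lt_of_ne' fun h0 => h ?_
  rw [← inner_eq_mul_norm_iff_angle_eq_zero (ne_zero_of_mem_unit_sphere x)
    (ne_zero_of_mem_unit_sphere y)] at h0
  rw [sphere_ext_iff, h0]
  simp

/-- Along the great circle in the direction of the gradient the distance to x is |t|, so f - t²/2
has a local maximum at t = 0, where its derivative is the norm of the gradient. -/
theorem grad_eq_zero_of_le_rdist_sq {f : S2 → ℝ} (hf : MDifferentiable (𝓡 2) 𝓘(ℝ, ℝ) f) {x : S2}
    (h : ∀ z, f z - f x ≤ rdist z x ^ 2 / 2) : grad f x = 0 := by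
  refine dIncl_injective x ?_
  rw [map_zero]
  by_contra hV
  set V := dIncl x (grad f x) with hVdef
  have hxV : inner ℝ (x : R3) V = 0 := inner_coe_dIncl x _
  have hw : ‖‖V‖⁻¹ • V‖ = 1 := by
    rw [norm_smul, norm_inv, norm_norm, inv_mul_cancel₀ (norm_ne_zero_iff.2 hV)]
  have hxw : inner ℝ (x : R3) (‖V‖⁻¹ • V) = 0 := by rw [inner_smul_right, hxV, mul_zero]
  have h1 := hasDerivAt_comp_greatCircle x _ hw hxw 0 (hf _)
  rw [greatCircle_zero, ← hVdef] at h1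
  have h2 := h1.sub ((((hasDerivAt_id (0 : ℝ)).pow 2)).div_const 2)
  have hmax : IsLocalMax ((fun s => f (greatCircle x _ hw hxw s)) - fun t : ℝ => (id ^ 2) t / 2)
      0 := by
    filter_upwards [Ioo_mem_nhds (neg_lt_zero.2 Real.pi_pos) Real.pi_pos] with t ht
    have h3 := h (greatCircle x _ hw hxw t)
    rw [rdist_greatCircle x x _ hw hxw hxw, rdist_self, Real.cos_zero, one_mul, ← Real.cos_abs,
      Real.arccos_cos (abs_nonneg t) (abs_le.2 ⟨ht.1.le, ht.2.le⟩), sq_abs] at h3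
    simp [greatCircle_zero]
    linarith
  have h3 := hmax.hasDerivAt_eq_zero h2
  simp [inner_smul_right] at h3
  exact hV h3

/-- A `C²` function whose Hessian is the metric at a point where the gradient does not vanish is not
`c`-concave: positive curvature makes `d(·, y)²/2` strictly less convex than `g` in the directions
orthogonal to the geodesic to `y`. -/
theorem not_cconcave_of_hessEqMetricAt {f : S2 → ℝ} (hf2 : ContMDiff (𝓡 2) 𝓘(ℝ, ℝ) 2 f) {x : S2}
    (hg : grad f x ≠ 0) (hH : HessEqMetricAt f x) : ¬ CConcave f := by
  intro hc
  have hf := hf2.mdifferentiable two_ne_zero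
  obtain ⟨y, hy⟩ := hc.exists_support x
  have hxy : x ≠ y := by
    rintro rfl
    refine hg (grad_eq_zero_of_le_rdist_sq hf fun z => ?_)
    simpa [rdist_self] using hy z
  -- This w is tangent at x and normal to the geodesic towards y; the choice also covers the
  -- antipodal case y = -x.
  obtain ⟨w, hw, hxw, hyw⟩ := exists_unit_orthogonal x y
  obtain ⟨u, hu⟩ := exists_dIncl_eq hxw
  have hess1 : hess f x u u = 1 := by
    rw [hH, inner_eq, hu, real_inner_self_eq_norm_sq, hw, one_pow]
  have h2 := hasDerivAt_deriv_comp_greatCircle x w hw hxw hf (mdifferentiable_dIncl_grad hf2 x) hu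
  rw [hess1] at h2
  have hθ : rdist x y ≤ Real.pi := by
    rw [rdist_eq_angle]
    exact angle_le_pi _ _
  obtain ⟨c, hc1, hc⟩ := exists_arccos_sq_le (rdist_pos hxy) hθ
  refine false_of_le_add_mul_sq
    (fun t => (hasDerivAt_comp_greatCircle x w hw hxw t (hf _)).differentiableAt) h2 hc1 ?_
  filter_upwards [hc] with t ht
  have h3 := hy (greatCircle x w hw hxw t)
  rw [rdist_greatCircle x y w hw hxw hyw] at h3
  rw [greatCircle_zero]
  linarith

end

/-! ### The example: ridge functions with Hessian at most `g`. -/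

section

open Filter Topology

/-- An even function with second derivative `1 / (1 + K |t|)²`; it is small when `K` is large. -/
def ridge (K t : ℝ) : ℝ := ∫ s in (0 : ℝ)..t, s / (1 + K * |s|)

section ridge

variable {K : ℝ}

theorem one_add_mul_abs_pos (hK : 0 ≤ K) (t : ℝ) : 0 < 1 + K * |t| := by positivity

theorem continuous_div_one_add_mul_abs (hK : 0 ≤ K) :
    Continuous fun t : ℝ => t / (1 + K * |t|) := by
  have h := one_add_mul_abs_pos hK
  exact continuous_id.div (by fun_prop) fun t => (h t).ne'

theorem hasDerivAt_ridge (hK : 0 ≤ K) (t : ℝ) : HasDerivAt (ridge K) (t / (1 + K * |t|)) t :=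
  (continuous_div_one_add_mul_abs hK).integral_hasStrictDerivAt 0 t |>.hasDerivAt

theorem hasDerivAt_div_one_add_mul_abs (hK : 0 ≤ K) (t : ℝ) :
    HasDerivAt (fun t : ℝ => t / (1 + K * |t|)) (1 / (1 + K * |t|) ^ 2) t := by
  have h := (one_add_mul_abs_pos hK t).ne'
  rcases lt_trichotomy t 0 with ht | rfl | ht
  · refine ((hasDerivAt_id t).div (((hasDerivAt_abs_neg ht).const_mul K).const_add 1) h).congr_deriv
      ?_
    simp only [id, abs_of_neg ht]
    congr 1
    ring
  · rw [hasDerivAt_iff_tendsto_slope_zero]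
    have h1 : Continuous fun t : ℝ => 1 / (1 + K * |t|) :=
      continuous_const.div (by fun_prop) fun t => (one_add_mul_abs_pos hK t).ne'
    have h2 := (h1.tendsto 0).mono_left (nhdsWithin_le_nhds (s := {0}ᶜ))
    simp only [abs_zero, mul_zero, add_zero, one_pow] at h2 ⊢
    refine h2.congr' ?_
    filter_upwards [self_mem_nhdsWithin] with t ht
    have ht : t ≠ 0 := ht
    simp
    field_simp
  · refine ((hasDerivAt_id t).div (((hasDerivAt_abs_pos ht).const_mul K).const_add 1) h).congr_deriv
      ?_
    simp only [id, abs_of_pos ht]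
    congr 1
    ring

theorem contDiff_ridge (hK : 0 ≤ K) : ContDiff ℝ 2 (ridge K) := by
  have h1 : deriv (ridge K) = fun t => t / (1 + K * |t|) :=
    funext fun t => (hasDerivAt_ridge hK t).deriv
  have h2 : deriv (fun t : ℝ => t / (1 + K * |t|)) = fun t => 1 / (1 + K * |t|) ^ 2 :=
    funext fun t => (hasDerivAt_div_one_add_mul_abs hK t).deriv
  have h3 : ContDiff ℝ 1 fun t : ℝ => t / (1 + K * |t|) := by
    refine contDiff_one_iff_deriv.2 ⟨fun t => (hasDerivAt_div_one_add_mul_abs hK t).differentiableAt,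
      ?_⟩
    rw [h2]
    exact continuous_const.div (by fun_prop) fun t => (pow_pos (one_add_mul_abs_pos hK t) 2).ne'
  rw [show (2 : ℕ∞ω) = 1 + 1 by norm_num, contDiff_succ_iff_deriv, h1]
  exact ⟨fun t => (hasDerivAt_ridge hK t).differentiableAt, by simp, h3⟩

theorem abs_ridge_le (hK : 0 < K) (t : ℝ) : |ridge K t| ≤ |t| / K := by
  have h : ‖ridge K t‖ ≤ 1 / K * |t - 0| := by
    refine intervalIntegral.norm_integral_le_of_norm_le_const fun s _ => ?_
    have h1 := one_add_mul_abs_pos hK.le s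
    rw [norm_div, Real.norm_eq_abs, Real.norm_of_nonneg h1.le, div_le_div_iff₀ h1 hK]
    linarith
  rw [Real.norm_eq_abs, sub_zero] at h
  exact h.trans_eq (by ring)

/-- The linear deficit |t|/3 does not depend on K, so K can be made large while ε is controlled
separately. The range |t| ≤ 2 is that of the four forms on the sphere. -/
theorem one_div_sq_le (hK : 1 ≤ K) {t : ℝ} (ht : |t| ≤ 2) :
    1 / (1 + K * |t|) ^ 2 ≤ 1 - |t| / 3 := by
  have h0 := abs_nonneg t
  have h1 : 1 + |t| ≤ (1 + K * |t|) ^ 2 := by nlinarith [mul_nonneg h0 (sub_nonneg.2 hK)]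
  rw [div_le_iff₀ (by positivity)]
  calc (1 : ℝ) ≤ (1 - |t| / 3) * (1 + |t|) := by nlinarith
    _ ≤ _ := by
      gcongr
      linarith

end ridge

section ridgeSum

variable {ι : Type*} [Fintype ι] (K : ℝ) (a : ι → R3) (b : R3)

/-- A sum of ridge functions plus a linear function on `ℝ³`. -/
def ridgeSum (z : R3) : ℝ := ∑ i, ridge K (inner ℝ (a i) z) / 3 + inner ℝ b z

/-- The gradient of `ridgeSum`. -/
def ridgeSumGrad (z : R3) : R3 :=
  ∑ i, (inner ℝ (a i) z / (1 + K * |inner ℝ (a i) z|) / 3) • a i + b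

variable {K}

theorem hasFDerivAt_ridgeSum (hK : 0 ≤ K) (z : R3) :
    HasFDerivAt (ridgeSum K a b) (innerSL ℝ (ridgeSumGrad K a b z)) z := by
  have h1 : ∀ i, HasFDerivAt (fun z : R3 => ridge K (inner ℝ (a i) z) / 3)
      ((inner ℝ (a i) z / (1 + K * |inner ℝ (a i) z|) / 3) • innerSL ℝ (a i)) z := fun i =>
    HasDerivAt.comp_hasFDerivAt (h₂ := fun t => ridge K t / 3) z
      ((hasDerivAt_ridge hK (inner ℝ (a i) z)).div_const 3) (innerSL ℝ (a i)).hasFDerivAt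
  refine ((HasFDerivAt.fun_sum fun i _ => h1 i).add (innerSL ℝ b).hasFDerivAt).congr_fderiv ?_
  simp [ridgeSumGrad]

theorem hasFDerivAt_ridgeSumGrad (hK : 0 ≤ K) (z : R3) :
    HasFDerivAt (ridgeSumGrad K a b)
      (∑ i, ((1 / (1 + K * |inner ℝ (a i) z|) ^ 2 / 3) • innerSL ℝ (a i)).smulRight (a i)) z := by
  have h1 : ∀ i, HasFDerivAt
      (fun z : R3 => inner ℝ (a i) z / (1 + K * |inner ℝ (a i) z|) / 3)
      ((1 / (1 + K * |inner ℝ (a i) z|) ^ 2 / 3) • innerSL ℝ (a i)) z := fun i =>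
    HasDerivAt.comp_hasFDerivAt (h₂ := fun t => t / (1 + K * |t|) / 3) z
      ((hasDerivAt_div_one_add_mul_abs hK (inner ℝ (a i) z)).div_const 3)
      (innerSL ℝ (a i)).hasFDerivAt
  exact (HasFDerivAt.fun_sum fun i _ => (h1 i).smul_const (a i)).add_const b

theorem contMDiff_ridgeSum (hK : 0 ≤ K) :
    ContMDiff (𝓡 2) 𝓘(ℝ, ℝ) 2 fun y : S2 => ridgeSum K a b y := by
  have h : ContDiff ℝ 2 (ridgeSum K a b) := by
    refine (ContDiff.sum fun i _ => ?_).add (innerSL ℝ b).contDiff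
    exact ((contDiff_ridge hK).comp (innerSL ℝ (a i)).contDiff).div_const 3
  exact h.contMDiff.comp contMDiff_coe_sphere

theorem hess_ridgeSum (hK : 0 ≤ K) (x : S2) (u v : TangentSpace (𝓡 2) x) :
    hess (fun y : S2 => ridgeSum K a b y) x u v =
      ∑ i, 1 / (1 + K * |inner ℝ (a i) (x : R3)|) ^ 2 / 3 *
        (inner ℝ (a i) (dIncl x u) * inner ℝ (a i) (dIncl x v)) -
      (∑ i, inner ℝ (a i) (x : R3) / (1 + K * |inner ℝ (a i) (x : R3)|) / 3 *
        inner ℝ (a i) (x : R3) + inner ℝ b (x : R3)) * inner ℝ (dIncl x u) (dIncl x v) := by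
  rw [hess_comp_coe (hasFDerivAt_ridgeSum a b hK) (hasFDerivAt_ridgeSumGrad a b hK x)]
  simp only [ridgeSumGrad, sum_apply, ContinuousLinearMap.smulRight_apply,
    smul_apply, innerSL_apply_apply, smul_eq_mul, inner_add_left, sum_inner,
    real_inner_smul_left, mul_assoc]

end ridgeSum

/-- The linear forms `x₀, x₁, x₀ + x₁, x₀ - x₁`, whose squares add up to `3 (x₀² + x₁²)`. -/
def directions : Fin 4 → R3 :=
  ![!₂[1, 0, 0], !₂[0, 1, 0], !₂[1, 1, 0], !₂[1, -1, 0]]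

/-- A small `C²` function on the sphere with `∇²f ≤ g`, `∇f(N) ≠ 0` and `∇²f(N) = g`. -/
def touching (K ε : ℝ) (y : S2) : ℝ := ridgeSum K directions !₂[ε, 0, 0] (y : R3)

theorem inner_directions_zero (z : R3) : inner ℝ (directions 0) z = z 0 := by
  simp [directions, PiLp.inner_apply, Fin.sum_univ_three]

theorem inner_directions_one (z : R3) : inner ℝ (directions 1) z = z 1 := by
  simp [directions, PiLp.inner_apply, Fin.sum_univ_three]

theorem inner_directions_two (z : R3) : inner ℝ (directions 2) z = z 0 + z 1 := by
  simp [directions, PiLp.inner_apply, Fin.sum_univ_three]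

theorem inner_directions_three (z : R3) : inner ℝ (directions 3) z = z 0 - z 1 := by
  simp [directions, PiLp.inner_apply, Fin.sum_univ_three]
  ring

theorem inner_first (ε : ℝ) (z : R3) : inner ℝ (!₂[ε, 0, 0] : R3) z = ε * z 0 := by
  simp [PiLp.inner_apply, Fin.sum_univ_three, mul_comm]

theorem sum_sq_coe (x : S2) : (x : R3) 0 ^ 2 + (x : R3) 1 ^ 2 + (x : R3) 2 ^ 2 = 1 := by
  have h := EuclideanSpace.real_norm_sq_eq (x : R3)
  rw [norm_eq_of_mem_sphere, Fin.sum_univ_three] at h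
  linarith

theorem abs_coe_zero_le (x : S2) : |(x : R3) 0| ≤ 1 := by
  rw [← sq_le_one_iff_abs_le_one]
  nlinarith [sum_sq_coe x, sq_nonneg ((x : R3) 1), sq_nonneg ((x : R3) 2)]

theorem abs_coe_one_le (x : S2) : |(x : R3) 1| ≤ 1 := by
  rw [← sq_le_one_iff_abs_le_one]
  nlinarith [sum_sq_coe x, sq_nonneg ((x : R3) 0), sq_nonneg ((x : R3) 2)]

theorem abs_inner_directions_le (x : S2) (i : Fin 4) : |inner ℝ (directions i) (x : R3)| ≤ 2 := by
  have h0 := abs_coe_zero_le x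
  have h1 := abs_coe_one_le x
  fin_cases i
  · simpa [inner_directions_zero] using h0.trans one_le_two
  · simpa [inner_directions_one] using h1.trans one_le_two
  · simpa [inner_directions_two] using (abs_add_le _ _).trans (by linarith)
  · simpa [inner_directions_three] using (abs_sub _ _).trans (by linarith)

theorem abs_touching_le {K ε : ℝ} (hK : 0 < K) (hε : 0 ≤ ε) (y : S2) :
    |touching K ε y| ≤ 8 / 3 / K + ε := by
  have h1 : ∀ i, |ridge K (inner ℝ (directions i) (y : R3)) / 3| ≤ 2 / 3 / K := fun i => by
    rw [abs_div, abs_of_pos (by norm_num : (0 : ℝ) < 3)]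
    calc _ ≤ 2 / K / 3 := by
          gcongr
          refine (abs_ridge_le hK _).trans ?_
          gcongr
          exact abs_inner_directions_le y i
      _ = _ := by ring
  have h2 := Finset.abs_sum_le_sum_abs
    (fun i => ridge K (inner ℝ (directions i) (y : R3)) / 3) Finset.univ
  have h3 := Finset.sum_le_sum fun i (_ : i ∈ Finset.univ) => h1 i
  have h4 : |ε * (y : R3) 0| ≤ ε := by
    rw [abs_mul, abs_of_nonneg hε]
    exact mul_le_of_le_one_right hε (abs_coe_zero_le y)
  rw [touching, ridgeSum, inner_first]
  refine (abs_add_le _ _).trans (add_le_add ((h2.trans h3).trans_eq ?_) h4)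
  simp
  ring

/-- The ridges lose at least |x₀| (V₀² + V₁²)/27 against the horizontal metric: a factor 1/3 each
from `one_div_sq_le`, the normalization and `hkey`. This pays for the horizontal part of -ε x₀ |V|²;
the V₂² missing from the ridge terms pays for the rest. -/
theorem touching_hessLe {K ε : ℝ} (hK : 1 ≤ K) (hε0 : 0 ≤ ε) (hε : ε ≤ 1 / 27) (x : S2) :
    HessLeMetricAt (touching K ε) x := by
  intro v
  have hK0 : 0 ≤ K := zero_le_one.trans hK
  have hess_eq := hess_ridgeSum directions !₂[ε, 0, 0] hK0 x v v
  set V := dIncl x v with hV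
  have hvv : inner ℝ V V = V 0 ^ 2 + V 1 ^ 2 + V 2 ^ 2 := by
    rw [real_inner_self_eq_norm_sq, EuclideanSpace.real_norm_sq_eq, Fin.sum_univ_three]
  -- The radial derivative of each ridge is nonnegative, so it only lowers the spherical Hessian.
  have hnn : ∀ i, 0 ≤ inner ℝ (directions i) (x : R3) /
      (1 + K * |inner ℝ (directions i) (x : R3)|) / 3 * inner ℝ (directions i) (x : R3) :=
    fun i => by
      have h1 := one_add_mul_abs_pos hK0 (inner ℝ (directions i) (x : R3))
      rw [div_mul_eq_mul_div, div_mul_eq_mul_div, ← sq]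
      positivity
  have hS := Finset.sum_nonneg fun i (_ : i ∈ Finset.univ) => hnn i
  have hle := Finset.sum_le_sum fun i (_ : i ∈ Finset.univ) =>
    mul_le_mul_of_nonneg_right (div_le_div_of_nonneg_right
      (one_div_sq_le hK (abs_inner_directions_le x i)) (by norm_num : (0 : ℝ) ≤ 3))
      (mul_self_nonneg (inner ℝ (directions i) V))
  rw [Fin.sum_univ_four (fun i => (1 - _ / 3) / 3 * _)] at hle
  simp only [inner_directions_zero, inner_directions_one, inner_directions_two,
    inner_directions_three] at hle
  set X := (x : R3) with hX
  have hx0 : |X 0| ≤ 1 := abs_coe_zero_le x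
  have hkey : |X 0| * (V 0 ^ 2 + V 1 ^ 2) / 3 ≤ |X 0| * V 0 ^ 2 + |X 1| * V 1 ^ 2 +
      |X 0 + X 1| * (V 0 + V 1) ^ 2 + |X 0 - X 1| * (V 0 - V 1) ^ 2 := by
    have h2 : 2 * |X 0| ≤ |X 0 + X 1| + |X 0 - X 1| := by
      have := abs_add_le (X 0 + X 1) (X 0 - X 1)
      rwa [show X 0 + X 1 + (X 0 - X 1) = 2 * X 0 by ring, abs_mul, abs_two] at this
    have hx0 := abs_nonneg (X 0)
    have hx1 := mul_nonneg (abs_nonneg (X 1)) (sq_nonneg (V 1))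
    have hp := mul_nonneg (abs_nonneg (X 0 + X 1)) (sq_nonneg (V 0 + V 1))
    have hm := mul_nonneg (abs_nonneg (X 0 - X 1)) (sq_nonneg (V 0 - V 1))
    -- One of |X₀ ± X₁| is at least |X₀|. With that sign, V₀² + (V₀ ± V₁)² - (V₀² + V₁²)/3 = (3V₀ ±
    -- 2V₁)²/6 + V₀²/6.
    rcases le_total |X 0| |X 0 + X 1| with h | h
    · have h3 := mul_le_mul_of_nonneg_right h (sq_nonneg (V 0 + V 1))
      have h5 := mul_nonneg hx0 (sq_nonneg (V 1))
      have h6 := mul_nonneg hx0 (sq_nonneg (V 0))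
      have h7 := mul_nonneg hx0 (sq_nonneg (3 * V 0 + 2 * V 1))
      nlinarith
    · have h3 := mul_le_mul_of_nonneg_right (show |X 0| ≤ |X 0 - X 1| by linarith)
        (sq_nonneg (V 0 - V 1))
      have h5 := mul_nonneg hx0 (sq_nonneg (V 1))
      have h6 := mul_nonneg hx0 (sq_nonneg (V 0))
      have h7 := mul_nonneg hx0 (sq_nonneg (3 * V 0 - 2 * V 1))
      nlinarith
  have hεx : -(1 / 27 * |X 0|) ≤ ε * X 0 := by
    have h1 := neg_abs_le (X 0)
    have h2 := mul_le_mul_of_nonneg_right hε (abs_nonneg (X 0))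
    nlinarith
  change hess (touching K ε) x v v = _ at hess_eq
  rw [hess_eq, inner_eq, ← hV, hvv, inner_first]
  have h1 := mul_le_mul_of_nonneg_right
    (show -(1 / 27 * |X 0|) ≤ _ from hεx.trans (le_add_of_nonneg_left hS))
    (show 0 ≤ V 0 ^ 2 + V 1 ^ 2 + V 2 ^ 2 by positivity)
  have h2 := mul_le_mul_of_nonneg_right hx0 (sq_nonneg (V 2))
  linarith [sq_nonneg (V 2)]

theorem coe_northPole : (northPole : R3) = EuclideanSpace.single 2 1 := rfl

theorem inner_directions_northPole (i : Fin 4) :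
    inner ℝ (directions i) (northPole : R3) = 0 := by
  fin_cases i <;>
    simp [coe_northPole, directions, PiLp.inner_apply]

theorem touching_hessEq {K ε : ℝ} (hK : 0 ≤ K) : HessEqMetricAt (touching K ε) northPole := by
  intro u v
  have h2 : ∀ w, dIncl northPole w 2 = 0 := fun w => by
    simpa [coe_northPole, EuclideanSpace.inner_single_left] using inner_coe_dIncl northPole w
  refine (hess_ridgeSum directions !₂[ε, 0, 0] hK northPole u v).trans ?_
  have h3 : inner ℝ (dIncl northPole u) (dIncl northPole v) =
      dIncl northPole u 0 * dIncl northPole v 0 + dIncl northPole u 1 * dIncl northPole v 1 := by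
    simp [PiLp.inner_apply, Fin.sum_univ_three, h2, mul_comm]
  rw [inner_eq, h3]
  simp only [inner_directions_northPole, inner_first]
  simp [Fin.sum_univ_four, inner_directions_zero, inner_directions_one, inner_directions_two,
    inner_directions_three, coe_northPole]
  ring

theorem grad_touching_ne_zero {K ε : ℝ} (hK : 0 ≤ K) (hε : 0 < ε) :
    grad (touching K ε) northPole ≠ 0 := by
  intro h
  have h1 := dIncl_grad_comp_coe (x := northPole)
    (hasFDerivAt_ridgeSum directions !₂[ε, 0, 0] hK northPole)
  change dIncl northPole (grad (touching K ε) northPole) = _ at h1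
  simp only [h, map_zero, ridgeSumGrad, inner_directions_northPole] at h1
  have h2 := congrArg (fun z : R3 => z 0) h1
  simp [coe_northPole] at h2
  exact hε.ne h2

end

end RoundSphere

end

open RoundSphere in
theorem mainTheorem4 :
    (∃ δ : ℝ, 0 < δ ∧
      ∀ f : S2 → ℝ, ContMDiff (𝓡 2) 𝓘(ℝ, ℝ) 2 f → (∀ y : S2, |f y| ≤ δ) →
        (∃ x : S2, grad f x ≠ 0 ∧ HessEqMetricAt f x) → ¬ CConcave f) ∧
    (∀ η : ℝ, 0 < η →
      ∃ f : S2 → ℝ, ContMDiff (𝓡 2) 𝓘(ℝ, ℝ) 2 f ∧ (∀ y : S2, |f y| ≤ η) ∧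
        grad f northPole ≠ 0 ∧ HessEqMetricAt f northPole ∧
        (∀ y : S2, HessLeMetricAt f y) ∧ ¬ CConcave f) ∧
    ¬ (∀ f : S2 → ℝ, ContMDiff (𝓡 2) 𝓘(ℝ, ℝ) 2 f →
        (CConcave f ↔ ∀ y : S2, HessLeMetricAt f y)) := by
  have hex : ∀ η : ℝ, 0 < η →
      ∃ f : S2 → ℝ, ContMDiff (𝓡 2) 𝓘(ℝ, ℝ) 2 f ∧ (∀ y : S2, |f y| ≤ η) ∧
        grad f northPole ≠ 0 ∧ HessEqMetricAt f northPole ∧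
        (∀ y : S2, HessLeMetricAt f y) ∧ ¬ CConcave f := by
    intro η hη
    -- The bound 8/(3K) + ε of `abs_touching_le` is split evenly: ε ≤ η/2, and K ≥ 16/(3η) makes the
    -- ridges at most η/2.
    have hε : 0 < min (η / 2) (1 / 27) := by positivity
    have hK1 : 1 ≤ max 1 (16 / 3 / η) := le_max_left _ _
    have hK0 : 0 < max 1 (16 / 3 / η) := zero_lt_one.trans_le hK1
    have hsmooth := contMDiff_ridgeSum directions !₂[min (η / 2) (1 / 27), 0, 0] hK0.le
    refine ⟨touching (max 1 (16 / 3 / η)) (min (η / 2) (1 / 27)), hsmooth, fun y => ?_,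
      grad_touching_ne_zero hK0.le hε, touching_hessEq hK0.le,
      fun y => touching_hessLe hK1 hε.le (min_le_right _ _) y,
      not_cconcave_of_hessEqMetricAt hsmooth
        (grad_touching_ne_zero hK0.le hε) (touching_hessEq hK0.le)⟩
    refine (abs_touching_le hK0 hε.le y).trans ?_
    have h1 : 8 / 3 / max 1 (16 / 3 / η) ≤ η / 2 := by
      rw [div_le_iff₀ hK0]
      have h2 : 16 / 3 / η ≤ max 1 (16 / 3 / η) := le_max_right _ _
      rw [div_le_iff₀ hη] at h2
      linarith
    linarith [min_le_left (η / 2) (1 / 27)]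
  refine ⟨⟨1, one_pos, fun f hf _ ⟨x, hx, hH⟩ =>
    not_cconcave_of_hessEqMetricAt hf hx hH⟩, hex, fun h => ?_⟩
  obtain ⟨f, hf, -, -, -, hle, hn⟩ := hex 1 one_pos
  exact hn ((h f hf).2 hle)
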